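/- There exist universal constants $c, c' > 0$ with the following property. Let $T$ be a finite tree with at least two vertices, with conductances $c(x,y)=c(y,x)>0$ on its edges (and $c(x,y)=0$ for non-edges), and let $(X_t)_{t\ge 0}$ be the random walk on $T$, i.e. the Markov chain with transition matrix $P(x,y)=c(x,y)/c(x)$, where $c(x)=\sum_y c(x,y)$; its stationary distribution is $\pi(x)=c(x)/\sum_y c(y)$. Let $$t_{\mathrm L}=\min\Big\{t\ge 0:\ \max_x\big\|P_L^t(x,\cdot)-\pi\big\|_{\mathrm{TV}}\le \tfrac14\Big\},\qquad P_L=\tfrac12(P+I),$$ be the total variation mixing time of the lazy walk, where $\|\mu-\nu\|_{\mathrm{TV}}=\frac12\sum_y|\mu(y)-\nu(y)|$. For a vertex $v$ let $t_v=\max_x \mathbb E_x[\tau_v]$, where $\tau_v=\min\{t\ge 0: X_t=v\}$ is the hitting time of $v$ by the (non-lazy) random walk $X$ and $\mathbb E_x$ is the expectation for the walk started at $x$. Call $v$ central if every connected component of $T-\{v\}$ has $\pi$-probability at most $1/2$. Then for every central vertex $v$ of $T$, both $t_{\mathrm L}$ and $t_v$ are finite and $$c\,t_v\ \le\ t_{\mathrm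 L}\ \le\ c'\,t_v .$$ -/

import Mathlib

open MeasureTheory ProbabilityTheory
open scoped ENNReal NNReal

noncomputable section

/-! ### Finite Markov chains -/

section MarkovChain

variable {V : Type*} [Fintype V] [DecidableEq V]

/-- The one-step kernel on `V` of a stochastic matrix `P`: from `x` jump to `y` with probability
`P x y`. -/
def stepKernel [MeasurableSpace V] [DiscreteMeasurableSpace V]
    (P : Matrix.rowStochastic ℝ V) : Kernel V V :=
  Kernel.ofFunOfCountable fun x => ∑ y, ENNReal.ofReal (P.1 x y) • Measure.dirac y

instance stepKernel.isMarkovKernel [MeasurableSpace V] [DiscreteMeasurableSpace V]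
    (P : Matrix.rowStochastic ℝ V) : IsMarkovKernel (stepKernel P) := by
  refine ⟨fun x => ⟨?_⟩⟩
  have hP := Matrix.mem_rowStochastic_iff_sum.1 P.2
  change (∑ y, ENNReal.ofReal (P.1 x y) • Measure.dirac y) Set.univ = 1
  simp only [Measure.finsetSum_apply, Measure.smul_apply, measure_univ, smul_eq_mul, mul_one]
  rw [← ENNReal.ofReal_sum_of_nonneg fun y _ => hP.1 x y, hP.2 x, ENNReal.ofReal_one]

/-- The law `ℙ_x` on the path space `ℕ → V` of the Markov chain `(X_t)` with transition matrix `P`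
started at `X_0 = x`: given the past `X_0, …, X_n`, the state `X_{n+1}` is distributed according to
row `X_n` of `P`. -/
def pathLaw [MeasurableSpace V] [DiscreteMeasurableSpace V]
    (P : Matrix.rowStochastic ℝ V) (x : V) : Measure (ℕ → V) :=
  Kernel.trajMeasure (X := fun _ => V) (Measure.dirac x) fun n =>
    (stepKernel P).comap (fun h : (i : Finset.Iic n) → V => h ⟨n, Finset.mem_Iic.2 le_rfl⟩)
      (measurable_pi_apply _)

/-- The first hitting time `τ_A = min {t ≥ 0 : X_t ∈ A}` of a path (`⊤` if `A` is never hit). -/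
def hitTime (A : Set V) (ω : ℕ → V) : ℕ∞ :=
  hittingAfter (fun (t : ℕ) (ω : ℕ → V) => ω t) A 0 ω

/-- The expected hitting time `𝔼_x[τ_A]`, with values in `[0, ∞]`. -/
def expHitTime [MeasurableSpace V] [DiscreteMeasurableSpace V]
    (P : Matrix.rowStochastic ℝ V) (x : V) (A : Set V) : ℝ≥0∞ :=
  ∫⁻ ω, (hitTime A ω : ℝ≥0∞) ∂(pathLaw P x)

/-- Total variation distance between two probability vectors on a finite set. -/
def tvDist (μ ν : V → ℝ) : ℝ := (∑ y, |μ y - ν y|) / 2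

/-- The transition matrix `(P + I) / 2` of the lazy version of the chain. -/
def lazyMatrix (P : Matrix V V ℝ) : Matrix V V ℝ := (1 / 2 : ℝ) • (P + 1)

/-- `d_L(t) = max_x ‖P_L^t(x, ·) - π‖`. -/
def lazyDist (P : Matrix V V ℝ) (π : V → ℝ) (t : ℕ) : ℝ :=
  ⨆ x, tvDist ((lazyMatrix P ^ t) x) π

/-- `t_L(ε) = min {t ≥ 0 : d_L(t) ≤ ε}`, the total variation mixing time of the lazy chain
(`⊤` if there is no such `t`). -/
def lazyMixingTime (P : Matrix V V ℝ) (π : V → ℝ) (ε : ℝ) : ℝ≥0∞ :=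
  ⨅ (t : ℕ) (_ : lazyDist P π t ≤ ε), (t : ℝ≥0∞)

end MarkovChain

/-! ### Trees with conductances -/

/-- A tree on the vertex set `V` with conductances on its edges: a positive weight
`c x y = c y x` for every edge, extended by `0` to pairs that are not edges. -/
structure ConductanceTree (V : Type*) where
  graph : SimpleGraph V
  isTree : graph.IsTree
  c : V → V → ℝ
  symm : ∀ x y, c x y = c y x
  pos : ∀ x y, graph.Adj x y → 0 < c x y
  zero : ∀ x y, ¬ graph.Adj x y → c x y = 0

namespace ConductanceTree

theorem c_nonneg {V : Type*} (T : ConductanceTree V) (x y : V) : 0 ≤ T.c x y := by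
  by_cases h : T.graph.Adj x y
  · exact (T.pos x y h).le
  · exact (T.zero x y h).ge

variable {V : Type*} [Fintype V]

/-- The total conductance `c(x) = ∑_y c(x, y)` of the edges at `x`. -/
def weight (T : ConductanceTree V) (x : V) : ℝ := ∑ y, T.c x y

theorem weight_pos [Nontrivial V] (T : ConductanceTree V) (x : V) : 0 < T.weight x := by
  obtain ⟨y, hy⟩ := T.isTree.1.preconnected.exists_adj_of_nontrivial x
  exact Finset.sum_pos' (fun z _ => T.c_nonneg x z) ⟨y, Finset.mem_univ _, T.pos x y hy⟩

/-- The transition matrix `P(x, y) = c(x, y) / c(x)` of the random walk on the tree. -/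
def walk [DecidableEq V] [Nontrivial V] (T : ConductanceTree V) : Matrix.rowStochastic ℝ V :=
  ⟨Matrix.of fun x y => T.c x y / T.weight x, by
    refine Matrix.mem_rowStochastic_iff_sum.2 ⟨fun x y => ?_, fun x => ?_⟩
    · exact div_nonneg (T.c_nonneg x y) (T.weight_pos x).le
    · simp only [Matrix.of_apply]
      rw [← Finset.sum_div]
      exact div_self (T.weight_pos x).ne'⟩

/-- The stationary distribution `π(x) = c(x) / ∑_y c(y)` of the random walk. -/
def stat (T : ConductanceTree V) (x : V) : ℝ := T.weight x / ∑ y, T.weight y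

/-- `π` is a probability vector. -/
theorem sum_stat [Nontrivial V] (T : ConductanceTree V) : ∑ x, T.stat x = 1 := by
  simp only [stat]
  rw [← Finset.sum_div]
  exact div_self (Finset.sum_pos (fun x _ => T.weight_pos x) Finset.univ_nonempty).ne'

/-- `π P = π`. -/
theorem stat_vecMul_walk [DecidableEq V] [Nontrivial V] (T : ConductanceTree V) :
    Matrix.vecMul T.stat T.walk.1 = T.stat := by
  funext y
  have h : ∀ x, T.stat x * T.walk.1 x y = T.c y x / ∑ z, T.weight z := fun x => by
    have := (T.weight_pos x).ne'
    simp only [stat, walk, Matrix.of_apply, T.symm y x]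
    field_simp
  simp only [Matrix.vecMul, dotProduct, h]
  rw [← Finset.sum_div]
  rfl

/-- The stationary probability `π(A)` of a set of vertices. -/
def statSet (T : ConductanceTree V) (A : Set V) : ℝ := ∑ x, A.indicator T.stat x

/-- A node `v` is central if each connected component of `T - {v}` has stationary probability at
most `1/2`. -/
def IsCentral (T : ConductanceTree V) (v : V) : Prop :=
  ∀ K : (T.graph.induce ({v}ᶜ : Set V)).ConnectedComponent,
    T.statSet (Subtype.val '' K.supp) ≤ 1 / 2

/-- `t_L = t_L(1/4)`, the mixing time of the lazy random walk on the tree. -/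
def lazyMix [DecidableEq V] [Nontrivial V] (T : ConductanceTree V) : ℝ≥0∞ :=
  lazyMixingTime T.walk.1 T.stat (1 / 4)

/-- `t_v = max_x 𝔼_x[τ_v]` for the (non-lazy) random walk on the tree. -/
def maxHit [DecidableEq V] [Nontrivial V] [MeasurableSpace V] [DiscreteMeasurableSpace V]
    (T : ConductanceTree V) (v : V) : ℝ≥0∞ :=
  ⨆ x, expHitTime T.walk x {v}

end ConductanceTree

end

/-! ### Expected hitting times and first-step analysis -/

/-! Write `g` for the expected hitting time of `v` by the lazy walk, which is twice that of the
walk, and `M` for a bound on `g`.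

Lower bound. A component `K` of `T - {v}` can be left only through `v`, so starting in `K`, up to
time `t` the walk has either hit `v` or is still in `K`. Hence `g ≤ t + M * P_L^t(x, K)` on `K`
(`le_add_mul_sum_indicator_pow`). If `t` is a mixing time and `v` is central, then `P_L^t(x, K) ≤
1/2 + 1/4`. With `M = max g` this gives `M ≤ 4t`, that is, `t_v ≤ 2t`.

Upper bound, for any `v`. Let `f s` be the density with respect to `π` of the lazy chain from `v` at
time `s`, minus one. Then `g` solves the Poisson equation `L g - g = f 0`, so the return sums of `f
s v` telescope to `(L ^ N g) v ≤ M`. By reversibility `f (2n) v = ‖f n‖²`, which dominates the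
squared `L¹` distance; laziness makes the odd terms nonnegative. So the chain from `v` is mixed
after a multiple of `M` steps (`tvDist_lazyMatrix_pow_le`). From another start, one first waits for
`v` to be hit (`mul_tvDist_pow_add_le`).

Both halves use `g` only through its first-step equations, its value `0` at `v` and its finiteness.
-/

theorem ENat.toENNReal_eq_tsum (k : ℕ∞) :
    (k : ℝ≥0∞) = ∑' t : ℕ, if (t : ℕ∞) < k then 1 else 0 := by
  induction k using ENat.recTopCoe with
  | top => simp
  | coe n =>
    rw [tsum_eq_sum (s := Finset.range n) (by simp), Finset.sum_congr rfl
      (g := fun _ => (1 : ℝ≥0∞)) (fun t ht => by simpa using ht)]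
    simp

section HittingTime

variable {V : Type*}

theorem lt_hitTime_iff (A : Set V) (ω : ℕ → V) (t : ℕ) :
    (t : ℕ∞) < hitTime A ω ↔ ∀ j ≤ t, ω j ∉ A := by
  rw [← not_le]
  have h : hitTime A ω ≤ (t : ℕ∞) ↔ ∃ j ∈ Set.Icc 0 t, ω j ∈ A :=
    hittingAfter_le_iff (u := fun (t : ℕ) (ω : ℕ → V) => ω t)
  rw [h]
  simp

variable [Fintype V] [DecidableEq V] (P : Matrix.rowStochastic ℝ V)

/-- The operator `f ↦ P (1_{≠ v} f)` of the chain killed at `v`. -/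
noncomputable def killedStep (v : V) (f : V → ℝ≥0∞) (x : V) : ℝ≥0∞ :=
  ∑ y, ENNReal.ofReal (P.1 x y) * if y = v then 0 else f y

/-- `ℙ_x(τ_v > t)`. -/
noncomputable def survival (v : V) (t : ℕ) (x : V) : ℝ≥0∞ :=
  if x = v then 0 else (killedStep P v)^[t] 1 x

theorem survival_self (v : V) (t : ℕ) : survival P v t v = 0 := if_pos rfl

theorem survival_zero {v x : V} (hx : x ≠ v) : survival P v 0 x = 1 := if_neg hx

theorem survival_succ {v x : V} (hx : x ≠ v) (t : ℕ) :
    survival P v (t + 1) x = ∑ y, ENNReal.ofReal (P.1 x y) * survival P v t y := by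
  rw [survival, if_neg hx, Function.iterate_succ_apply']
  rfl

variable [MeasurableSpace V] [DiscreteMeasurableSpace V]

theorem lintegral_stepKernel (x : V) (f : V → ℝ≥0∞) :
    ∫⁻ y, f y ∂(stepKernel P x) = ∑ y, ENNReal.ofReal (P.1 x y) * f y := by
  change ∫⁻ y, f y ∂(∑ y, ENNReal.ofReal (P.1 x y) • Measure.dirac y) = _
  rw [lintegral_finsetSum_measure]
  simp

theorem map_eval_zero_pathLaw (x : V) :
    (pathLaw P x).map (fun ω => ω 0) = Measure.dirac x := by
  rw [pathLaw, Kernel.trajMeasure, Measure.map_comp _ _ (by fun_prop)]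
  have h : (fun ω : ℕ → V => ω 0) =
      (fun h : Finset.Iic 0 → V => h ⟨0, Finset.mem_Iic.2 le_rfl⟩) ∘ Preorder.frestrictLe 0 := rfl
  rw [h, Kernel.map_comp_right _ (Preorder.measurable_frestrictLe 0) (by fun_prop),
    Kernel.traj_map_frestrictLe, Kernel.partialTraj_self, ← Measure.map_comp _ _ (by fun_prop), Measure.id_comp,
    Measure.map_map (by fun_prop) (by fun_prop)]
  exact Measure.map_dirac' (f := (fun h : Finset.Iic 0 → V => h ⟨0, Finset.mem_Iic.2 le_rfl⟩) ∘
    (MeasurableEquiv.piUnique fun _ : Finset.Iic 0 => V).symm) (by fun_prop) x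

instance (x : V) : IsProbabilityMeasure (pathLaw P x) := by
  unfold pathLaw; infer_instance

/-- The Markov property at time `n`. -/
theorem lintegral_pathLaw_succ (x : V) (n : ℕ) (F : (Finset.Iic n → V) → V → ℝ≥0∞) :
    ∫⁻ ω, F (Preorder.frestrictLe n ω) (ω (n + 1)) ∂(pathLaw P x) =
      ∫⁻ ω, ∑ y, ENNReal.ofReal (P.1 (ω n) y) * F (Preorder.frestrictLe n ω) y
        ∂(pathLaw P x) := by
  have hm : ∀ G : (Finset.Iic n → V) × V → ℝ≥0∞, Measurable G := fun G => .of_discrete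
  have h := Kernel.map_frestrictLe_trajMeasure_compProd_eq_map_trajMeasure (X := fun _ => V)
    (μ₀ := Measure.dirac x) (κ := fun n => (stepKernel P).comap
      (fun h : (i : Finset.Iic n) → V => h ⟨n, Finset.mem_Iic.2 le_rfl⟩)
      (measurable_pi_apply _)) (a := n)
  have h' := congrArg (fun μ => ∫⁻ p, F p.1 p.2 ∂μ) h
  rw [lintegral_map (hm _) (by fun_prop), Measure.lintegral_compProd (hm _),
    lintegral_map .of_discrete (by fun_prop)] at h'
  refine h'.symm.trans (lintegral_congr fun ω => ?_)
  rw [Kernel.comap_apply, lintegral_stepKernel]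
  rfl

/-- The Markov property at the last step replaces `f` by `killedStep P v f`, so the induction must
run over all `f`. With `f = 1` this identifies `survival`. -/
theorem lintegral_killed (v x : V) (t : ℕ) (f : V → ℝ≥0∞) :
    ∫⁻ ω, (if ∀ j ≤ t, ω j ≠ v then f (ω t) else 0) ∂(pathLaw P x) =
      if x = v then 0 else (killedStep P v)^[t] f x := by
  induction t generalizing f with
  | zero =>
    have h := lintegral_map (μ := pathLaw P x) (g := fun ω => ω 0)
      (f := fun y => if y = v then 0 else f y) .of_discrete (by fun_prop)
    rw [map_eval_zero_pathLaw, lintegral_dirac] at h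
    simpa [ite_not] using h.symm
  | succ t ih =>
    have h := lintegral_pathLaw_succ P x t fun h y =>
      if (∀ j, h j ≠ v) ∧ y ≠ v then f y else 0
    rw [Function.iterate_succ_apply, ← ih]
    refine Eq.trans (lintegral_congr fun ω => ?_) (h.trans (lintegral_congr fun ω => ?_))
    · refine if_congr ?_ rfl rfl
      constructor
      · exact fun H => ⟨fun j => H j ((Finset.mem_Iic.1 j.2).trans t.le_succ), H _ le_rfl⟩
      · rintro ⟨H, H'⟩ j hj
        rcases Nat.le_succ_iff.1 hj with hj | rfl
        · exact H ⟨j, Finset.mem_Iic.2 hj⟩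
        · exact H'
    · have hiff : (∀ j, Preorder.frestrictLe t ω j ≠ v) ↔ ∀ j ≤ t, ω j ≠ v :=
        ⟨fun H j hj => H ⟨j, Finset.mem_Iic.2 hj⟩, fun H j => H j (Finset.mem_Iic.1 j.2)⟩
      simp only [hiff, killedStep]
      split_ifs with H
      · refine Finset.sum_congr rfl fun y _ => ?_
        rw [if_congr (and_iff_right H) rfl rfl, ite_not]
      · simp [H]

theorem expHitTime_eq_tsum (v x : V) :
    expHitTime P x {v} = ∑' t, survival P v t x := by
  have hm (t : ℕ) : Measurable fun ω : ℕ → V => if ∀ j ≤ t, ω j ≠ v then (1 : ℝ≥0∞) else 0 := by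
    refine Measurable.ite ?_ measurable_const measurable_const
    have : {ω : ℕ → V | ∀ j ≤ t, ω j ≠ v} = ⋂ j ∈ Set.Iic t, (fun ω => ω j) ⁻¹' {v}ᶜ := by
      ext; simp
    rw [this]
    exact .biInter (Set.to_countable _) fun j _ => measurable_pi_apply j .of_discrete
  simp_rw [expHitTime, ENat.toENNReal_eq_tsum, lt_hitTime_iff, Set.mem_singleton_iff]
  rw [lintegral_tsum fun t => (hm t).aemeasurable]
  exact tsum_congr fun t => lintegral_killed P v x t 1

theorem expHitTime_self (v : V) : expHitTime P v {v} = 0 := by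
  simp [expHitTime_eq_tsum, survival_self]

/-- First-step analysis. -/
theorem expHitTime_of_ne {v x : V} (hx : x ≠ v) :
    expHitTime P x {v} = 1 + ∑ y, ENNReal.ofReal (P.1 x y) * expHitTime P y {v} := by
  simp_rw [expHitTime_eq_tsum]
  rw [tsum_eq_zero_add' ENNReal.summable, survival_zero P hx]
  simp_rw [survival_succ P hx, ← ENNReal.tsum_mul_left]
  rw [Summable.tsum_finsetSum fun _ _ => ENNReal.summable]

/-- The expected hitting time is the smallest solution of the first-step equations. -/
theorem expHitTime_le {v : V} {s : V → ℝ≥0∞}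
    (hs : ∀ x, x ≠ v → 1 + ∑ y, ENNReal.ofReal (P.1 x y) * s y ≤ s x) (x : V) :
    expHitTime P x {v} ≤ s x := by
  rw [expHitTime_eq_tsum]
  -- The partial sums are the expectations of `τ_v` truncated at `n`; they start at `0` and stay
  -- below any supersolution.
  refine ENNReal.tsum_le_of_sum_range_le fun n => ?_
  induction n generalizing x with
  | zero => simp
  | succ n ih =>
    by_cases hx : x = v
    · simp [hx, survival_self]
    · refine le_trans ?_ (hs x hx)
      rw [Finset.sum_range_succ', survival_zero P hx, add_comm]
      simp_rw [survival_succ P hx]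
      rw [Finset.sum_comm]
      simp_rw [← Finset.mul_sum]
      gcongr with y
      exact ih y

end HittingTime

/-! ### Total variation distance and reversible matrices -/

section TotalVariation

variable {V : Type*} [Fintype V]

theorem tvDist_le_one {μ ν : V → ℝ} (hμ : ∀ x, 0 ≤ μ x) (hν : ∀ x, 0 ≤ ν x)
    (hμ1 : ∑ x, μ x = 1) (hν1 : ∑ x, ν x = 1) : tvDist μ ν ≤ 1 := by
  have : ∑ y, |μ y - ν y| ≤ ∑ y, (μ y + ν y) := Finset.sum_le_sum fun y _ =>
    abs_sub_le_iff.2 ⟨by linarith [hν y], by linarith [hμ y]⟩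
  rw [Finset.sum_add_distrib, hμ1, hν1] at this
  rw [tvDist]
  linarith

theorem sum_indicator_le_add_tvDist {μ ν : V → ℝ} (hμ1 : ∑ x, μ x = 1) (hν1 : ∑ x, ν x = 1)
    (K : Set V) : ∑ x, K.indicator μ x ≤ ∑ x, K.indicator ν x + tvDist μ ν := by
  classical
  -- The signed term `μ x - ν x` on the right sums to zero, since both vectors have mass one.
  have h : ∀ x, 2 * (K.indicator μ x - K.indicator ν x) ≤ |μ x - ν x| + (μ x - ν x) := by
    intro x
    by_cases hx : x ∈ K
    · simp only [Set.indicator_of_mem hx]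
      linarith [le_abs_self (μ x - ν x)]
    · simp only [Set.indicator_of_notMem hx]
      linarith [neg_abs_le (μ x - ν x)]
  have := Finset.sum_le_sum fun x (_ : x ∈ Finset.univ) => h x
  rw [Finset.sum_add_distrib, ← Finset.mul_sum, Finset.sum_sub_distrib, Finset.sum_sub_distrib,
    hμ1, hν1] at this
  rw [tvDist]
  linarith

variable [DecidableEq V] {L : Matrix V V ℝ} {π : V → ℝ}

theorem tvDist_pow_succ_le_sum (hL : L ∈ Matrix.rowStochastic ℝ V) (t : ℕ) (x : V) :
    tvDist ((L ^ (t + 1)) x) π ≤ ∑ y, L x y * tvDist ((L ^ t) y) π := by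
  rw [Matrix.mem_rowStochastic_iff_sum] at hL
  have h : ∀ z, |(L ^ (t + 1)) x z - π z| ≤ ∑ y, L x y * |(L ^ t) y z - π z| := by
    intro z
    have : (L ^ (t + 1)) x z - π z = ∑ y, L x y * ((L ^ t) y z - π z) := by
      simp_rw [mul_sub, Finset.sum_sub_distrib, ← Finset.sum_mul, hL.2, one_mul, pow_succ',
        Matrix.mul_apply]
    rw [this]
    refine (Finset.abs_sum_le_sum_abs _ _).trans_eq (Finset.sum_congr rfl fun y _ => ?_)
    rw [abs_mul, abs_of_nonneg (hL.1 x y)]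
  simp_rw [tvDist, mul_div, ← Finset.sum_div, Finset.mul_sum]
  rw [Finset.sum_comm]
  gcongr with z
  exact h z

/-- A stochastic matrix acting on row vectors contracts `ℓ¹` and fixes `π`. -/
theorem tvDist_pow_succ_le (hL : L ∈ Matrix.rowStochastic ℝ V) (hπ : Matrix.vecMul π L = π)
    (t : ℕ) (x : V) : tvDist ((L ^ (t + 1)) x) π ≤ tvDist ((L ^ t) x) π := by
  rw [Matrix.mem_rowStochastic_iff_sum] at hL
  have h : ∀ z, |(L ^ (t + 1)) x z - π z| ≤ ∑ y, |(L ^ t) x y - π y| * L y z := by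
    intro z
    have : (L ^ (t + 1)) x z - π z = ∑ y, ((L ^ t) x y - π y) * L y z := by
      conv_lhs => rw [← hπ]
      simp_rw [sub_mul, Finset.sum_sub_distrib, pow_succ, Matrix.mul_apply]
      rfl
    rw [this]
    refine (Finset.abs_sum_le_sum_abs _ _).trans_eq (Finset.sum_congr rfl fun y _ => ?_)
    rw [abs_mul, abs_of_nonneg (hL.1 y z)]
  refine div_le_div_of_nonneg_right ?_ zero_le_two
  refine (Finset.sum_le_sum fun z _ => h z).trans_eq ?_
  rw [Finset.sum_comm]
  simp_rw [← Finset.mul_sum, hL.2, mul_one]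

/-- If `g` solves the first-step equations on a set `K` that can only be left through `v`, then
`g` is controlled by the probability of being in `K` at time `t`. -/
theorem le_add_mul_sum_indicator_pow (hL : L ∈ Matrix.rowStochastic ℝ V) {K : Set V} {v : V}
    (hK : ∀ x ∈ K, ∀ y ∉ K, y ≠ v → L x y = 0) {g : V → ℝ} {M : ℝ} (hgv : g v = 0)
    (hg : ∀ x ∈ K, g x = 1 + ∑ y, L x y * g y) (hM : ∀ x, g x ≤ M) (t : ℕ) :
    ∀ x ∈ K, g x ≤ t + M * ∑ y, K.indicator ((L ^ t) x) y := by
  classical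
  have hM0 : 0 ≤ M := hgv ▸ hM v
  induction t with
  | zero =>
    intro x hx
    have : ∑ y, K.indicator ((L ^ 0) x) y = 1 := by
      rw [Finset.sum_eq_single x _ (by simp)]
      · simp [hx]
      · intro y _ hy
        simp [Set.indicator_apply, hy.symm]
    rw [this]
    simpa using hM x
  | succ t ih =>
    intro x hx
    have hpow : ∑ y, K.indicator ((L ^ (t + 1)) x) y =
        ∑ z, L x z * ∑ y, K.indicator ((L ^ t) z) y := by
      simp_rw [Finset.mul_sum]
      rw [Finset.sum_comm]
      refine Finset.sum_congr rfl fun y _ => ?_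
      by_cases hy : y ∈ K
      · simp [hy, pow_succ', Matrix.mul_apply]
      · simp [hy]
    have hpos : ∀ z, 0 ≤ ∑ y, K.indicator ((L ^ t) z) y := fun z => Finset.sum_nonneg fun y _ =>
      Set.indicator_nonneg (fun y _ => (Matrix.mem_rowStochastic_iff_sum.1 (pow_mem hL t)).1 z y) y
    rw [Matrix.mem_rowStochastic_iff_sum] at hL
    have hstep : ∑ z, L x z * g z ≤
        ∑ z, L x z * (t + M * ∑ y, K.indicator ((L ^ t) z) y) := by
      refine Finset.sum_le_sum fun z _ => ?_
      by_cases hz : z ∈ K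
      · exact mul_le_mul_of_nonneg_left (ih z hz) (hL.1 x z)
      by_cases hzv : z = v
      · rw [hzv, hgv]
        exact mul_le_mul_of_nonneg_left
          (add_nonneg t.cast_nonneg (mul_nonneg hM0 (hpos v))) (hL.1 x v)
      · simp [hK x hx z hz hzv]
    simp_rw [mul_add, Finset.sum_add_distrib, ← Finset.sum_mul, hL.2, one_mul, mul_left_comm _ M,
      ← Finset.mul_sum, ← hpow] at hstep
    rw [hg x hx]
    push_cast
    linarith

end TotalVariation

/-! ### Mixing of lazy reversible chains -/

section Reversible

open Matrix

variable {V : Type*} [Fintype V]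

/-- The inner product of `ℓ²(π)`. -/
def weightedInner (π f g : V → ℝ) : ℝ := ∑ x, π x * f x * g x

theorem sq_sum_mul_le {p : V → ℝ} (hp : ∀ x, 0 ≤ p x) (hp1 : ∑ x, p x = 1) (f : V → ℝ) :
    (∑ x, p x * f x) ^ 2 ≤ ∑ x, p x * f x ^ 2 := by
  have := Finset.sum_sq_le_sum_mul_sum_of_sq_le_mul Finset.univ (r := fun x => p x * f x)
    (f := p) (g := fun x => p x * f x ^ 2) (fun x _ => hp x)
    (fun x _ => mul_nonneg (hp x) (sq_nonneg _)) (fun x _ => le_of_eq (by ring))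
  rwa [hp1, one_mul] at this

variable {P : Matrix V V ℝ} {π : V → ℝ}

theorem weightedInner_mulVec (hrev : ∀ x y, π x * P x y = π y * P y x) (f g : V → ℝ) :
    weightedInner π f (P *ᵥ g) = weightedInner π (P *ᵥ f) g := by
  simp only [weightedInner, mulVec, dotProduct, Finset.mul_sum, Finset.sum_mul]
  rw [Finset.sum_comm]
  refine Finset.sum_congr rfl fun x _ => Finset.sum_congr rfl fun y _ => ?_
  linear_combination f y * g x * hrev y x

theorem sum_mul_mulVec [DecidableEq V] (hP : P ∈ rowStochastic ℝ V)
    (hrev : ∀ x y, π x * P x y = π y * P y x) (f : V → ℝ) :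
    ∑ x, π x * (P *ᵥ f) x = ∑ x, π x * f x := by
  have h := weightedInner_mulVec hrev 1 f
  have h1 : P *ᵥ 1 = 1 := hP.2
  rw [h1] at h
  simpa [weightedInner] using h

/-- Jensen's inequality in each row, then stationarity of `π` applied to `f ^ 2`. -/
theorem weightedInner_mulVec_self_le [DecidableEq V] (hP : P ∈ rowStochastic ℝ V)
    (hπ : ∀ x, 0 ≤ π x) (hrev : ∀ x y, π x * P x y = π y * P y x) (f : V → ℝ) :
    weightedInner π (P *ᵥ f) (P *ᵥ f) ≤ weightedInner π f f := by
  have h := sum_mul_mulVec hP hrev fun x => f x ^ 2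
  rw [mem_rowStochastic_iff_sum] at hP
  simp only [weightedInner, mul_assoc, ← sq]
  rw [← h]
  gcongr with x
  · exact hπ x
  · exact sq_sum_mul_le (hP.1 x) (hP.2 x) f

variable [DecidableEq V]

theorem lazyMatrix_mem_rowStochastic (hP : P ∈ rowStochastic ℝ V) :
    lazyMatrix P ∈ rowStochastic ℝ V := by
  have h1 := one_mem (rowStochastic ℝ V)
  rw [mem_rowStochastic_iff_sum] at *
  refine ⟨fun x y => ?_, fun x => ?_⟩
  · simp only [lazyMatrix, Matrix.smul_apply, Matrix.add_apply, smul_eq_mul]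
    linarith [hP.1 x y, h1.1 x y]
  · simp only [lazyMatrix, Matrix.smul_apply, Matrix.add_apply, smul_eq_mul]
    rw [← Finset.mul_sum, Finset.sum_add_distrib, hP.2, h1.2]
    norm_num

theorem lazyMatrix_mulVec (f : V → ℝ) (x : V) :
    (lazyMatrix P *ᵥ f) x = ((P *ᵥ f) x + f x) / 2 := by
  simp [lazyMatrix, smul_mulVec, add_mulVec]
  ring

omit [Fintype V] in
theorem lazyMatrix_reversible (hrev : ∀ x y, π x * P x y = π y * P y x) (x y : V) :
    π x * lazyMatrix P x y = π y * lazyMatrix P y x := by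
  simp only [lazyMatrix, Matrix.smul_apply, Matrix.add_apply, smul_eq_mul, one_apply]
  rcases eq_or_ne x y with rfl | h
  · rfl
  · simp only [if_neg h, if_neg h.symm]
    linear_combination hrev x y / 2

/-- The lazy chain is positive semidefinite on `ℓ²(π)`. -/
theorem weightedInner_lazyMatrix_nonneg (hP : P ∈ rowStochastic ℝ V)
    (hπ : ∀ x, 0 ≤ π x) (hrev : ∀ x y, π x * P x y = π y * P y x) (f : V → ℝ) :
    0 ≤ weightedInner π f (lazyMatrix P *ᵥ f) := by
  -- `4⟨f, Lf⟩ = 2⟨f, Pf⟩ + 2‖f‖² = ‖Pf + f‖² + (‖f‖² - ‖Pf‖²)`, and `P` is a contraction.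
  have h : weightedInner π f (lazyMatrix P *ᵥ f) =
      (weightedInner π (P *ᵥ f + f) (P *ᵥ f + f)
        + (weightedInner π f f - weightedInner π (P *ᵥ f) (P *ᵥ f))) / 4 := by
    simp only [weightedInner, lazyMatrix_mulVec, Pi.add_apply, ← Finset.sum_sub_distrib,
      ← Finset.sum_add_distrib, Finset.sum_div]
    refine Finset.sum_congr rfl fun x _ => by ring
  have h2 : 0 ≤ weightedInner π (P *ᵥ f + f) (P *ᵥ f + f) := Finset.sum_nonneg fun x _ => by
    rw [mul_assoc]; exact mul_nonneg (hπ x) (mul_self_nonneg _)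
  rw [h]
  linarith [weightedInner_mulVec_self_le hP hπ hrev f]

theorem pow_reversible (hrev : ∀ x y, π x * P x y = π y * P y x) (t : ℕ) (x y : V) :
    π x * (P ^ t) x y = π y * (P ^ t) y x := by
  induction t generalizing x y with
  | zero =>
    rcases eq_or_ne x y with rfl | h
    · rfl
    · simp [h, h.symm]
  | succ t ih =>
    rw [pow_succ, mul_apply, ← pow_succ, pow_succ', mul_apply, Finset.mul_sum, Finset.mul_sum]
    refine Finset.sum_congr rfl fun z _ => ?_
    linear_combination P z y * ih x z + (P ^ t) z x * hrev z y

/-- Let `g` be the expected hitting time of `v` for a lazy reversible chain. Then the chain started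
at `v` is mixed after a time of the order of `max g`. -/
theorem tvDist_lazyMatrix_pow_le (hP : P ∈ rowStochastic ℝ V)
    (hπ : ∀ x, 0 < π x) (hπ1 : ∑ x, π x = 1) (hrev : ∀ x y, π x * P x y = π y * P y x)
    {v : V} {g : V → ℝ} (hgv : g v = 0)
    (hg : ∀ x, x ≠ v → g x = 1 + (lazyMatrix P *ᵥ g) x) {M : ℝ} (hM : ∀ x, g x ≤ M) (n : ℕ) :
    n * (2 * tvDist ((lazyMatrix P ^ n) v) π) ^ 2 ≤ M := by
  set L := lazyMatrix P with hLdef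
  have hL : L ∈ rowStochastic ℝ V := lazyMatrix_mem_rowStochastic hP
  have hLrev : ∀ x y, π x * L x y = π y * L y x := lazyMatrix_reversible hrev
  -- the density of the chain started at `v`, minus one
  let f : ℕ → V → ℝ := fun s y => (L ^ s) y v / π v - 1
  have hfsucc : ∀ s, f (s + 1) = L *ᵥ f s := by
    intro s
    ext y
    have := (mem_rowStochastic_iff_sum.1 hL).2 y
    simp only [f, mulVec, dotProduct, mul_sub, mul_one, Finset.sum_sub_distrib, this,
      pow_succ', mul_apply, Finset.sum_div, mul_div_assoc]
  have hf : ∀ s, f s = L ^ s *ᵥ f 0 := by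
    intro s
    induction s with
    | zero => simp
    | succ s ih => rw [hfsucc, ih, mulVec_mulVec, pow_succ']
  have hmean : ∀ s, ∑ x, π x * f s x = 0 := by
    intro s
    induction s with
    | zero =>
      simp only [f, mul_sub, mul_one, Finset.sum_sub_distrib, hπ1, pow_zero, one_apply]
      rw [Finset.sum_eq_single v (by simp +contextual) (by simp)]
      simp [(hπ v).ne']
    | succ s ih => rw [hfsucc, sum_mul_mulVec hL hLrev, ih]
  have hinner0 : ∀ s, weightedInner π (f 0) (f s) = f s v := by
    intro s
    have : ∀ x, π x * f 0 x * f s x = (if x = v then f s v else 0) - π x * f s x := by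
      intro x
      simp only [f, pow_zero, one_apply]
      split_ifs with h
      · subst h
        field_simp [(hπ x).ne']
      · ring
    simp [weightedInner, this, hmean]
  have hinner : ∀ i j, weightedInner π (f i) (f j) = f (i + j) v := by
    intro i
    induction i with
    | zero => intro j; rw [hinner0, zero_add]
    | succ i ih =>
      intro j
      rw [hfsucc, ← weightedInner_mulVec hLrev, ← hfsucc, ih]
      congr 1
      omega
  have heven : ∀ j, f (2 * (j + 1)) v ≤ f (2 * j) v := by
    intro j
    rw [two_mul, two_mul, ← hinner, ← hinner, hfsucc]
    exact weightedInner_mulVec_self_le hL (fun x => (hπ x).le) hLrev _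
  have hodd : ∀ j, 0 ≤ f (2 * j + 1) v := by
    intro j
    have : 2 * j + 1 = j + (j + 1) := by omega
    rw [this, ← hinner, hfsucc]
    exact weightedInner_lazyMatrix_nonneg hP (fun x => (hπ x).le) hrev _
  -- the Poisson equation for `g`
  have hpoisson : L *ᵥ g - g = f 0 := by
    have hne : ∀ x, x ≠ v → (L *ᵥ g - g) x = f 0 x := by
      intro x hx
      simp [f, hx, hg x hx]
    -- The value at `v` is forced: both sides have `π`-mean zero and agree everywhere else.
    have hsum : ∑ x, π x * ((L *ᵥ g - g) x - f 0 x) = 0 := by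
      simp_rw [mul_sub, Finset.sum_sub_distrib, hmean, Pi.sub_apply, mul_sub,
        Finset.sum_sub_distrib, sum_mul_mulVec hL hLrev]
      ring
    rw [Finset.sum_eq_single v (fun x _ hx => by rw [hne x hx]; ring) (by simp)] at hsum
    ext x
    rcases eq_or_ne x v with rfl | hx
    · exact sub_eq_zero.1 ((mul_eq_zero.1 hsum).resolve_left (hπ x).ne')
    · exact hne x hx
  have hsum : ∀ N, ∑ s ∈ Finset.range N, f s v = (L ^ N *ᵥ g) v := by
    intro N
    induction N with
    | zero => simp [hgv]
    | succ N ih =>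
      rw [Finset.sum_range_succ, ih, hf, ← hpoisson, mulVec_sub, mulVec_mulVec, ← pow_succ]
      simp
  have hbound : ∀ N, (L ^ N *ᵥ g) v ≤ M := by
    intro N
    have hN := mem_rowStochastic_iff_sum.1 (pow_mem hL N)
    calc (L ^ N *ᵥ g) v ≤ ∑ y, (L ^ N) v y * M :=
          Finset.sum_le_sum fun y _ => mul_le_mul_of_nonneg_left (hM y) (hN.1 v y)
      _ = M := by rw [← Finset.sum_mul, hN.2, one_mul]
  -- Pair the times `2j` and `2j + 1`: for `j ≤ n` the even term is at least `f (2 * n) v`, and the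
  -- odd one is nonnegative. The alternative `n < N` confines the induction to `N ≤ n`.
  have hdouble : ∀ N, N * f (2 * n) v ≤ ∑ s ∈ Finset.range (2 * N), f s v ∨ n < N := by
    intro N
    rcases lt_or_ge n N with h | h
    · exact .inr h
    left
    have hanti : Antitone fun j => f (2 * j) v := antitone_nat_of_succ_le heven
    induction N with
    | zero => simp
    | succ N ih =>
      rw [mul_add, Finset.sum_range_succ, Finset.sum_range_succ]
      have h1 : f (2 * n) v ≤ f (2 * N) v := hanti (by omega)
      push_cast
      linarith [ih (by omega), hodd N]
  have hfinal : n * f (2 * n) v ≤ M :=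
    (((hdouble n).resolve_right (lt_irrefl n)).trans_eq (hsum _)).trans (hbound _)
  have htv : 2 * tvDist ((L ^ n) v) π = ∑ x, π x * |f n x| := by
    rw [tvDist, mul_div_cancel₀ _ two_ne_zero]
    refine Finset.sum_congr rfl fun x _ => ?_
    rw [← abs_of_pos (hπ x), ← abs_mul, abs_of_pos (hπ x)]
    congr 1
    have := pow_reversible hLrev n v x
    have := (hπ v).ne'
    simp only [f]
    field_simp
    linarith
  have hsq : (2 * tvDist ((L ^ n) v) π) ^ 2 ≤ f (2 * n) v := by
    rw [htv, two_mul, ← hinner]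
    refine (sq_sum_mul_le (fun x => (hπ x).le) hπ1 _).trans_eq ?_
    refine Finset.sum_congr rfl fun x _ => ?_
    rw [sq_abs]
    ring
  exact (mul_le_mul_of_nonneg_left hsq n.cast_nonneg).trans hfinal

/-- If the chain is `ε`-mixed from `v` at all times `≥ m`, it is mixed from everywhere after
additionally waiting for `v` to be hit. -/
theorem mul_tvDist_pow_add_le {L : Matrix V V ℝ} (hL : L ∈ rowStochastic ℝ V)
    (hπ : ∀ x, 0 ≤ π x) (hπ1 : ∑ x, π x = 1) (hπL : π ᵥ* L = π)
    {v : V} {g : V → ℝ} (hg0 : ∀ x, 0 ≤ g x)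
    (hg : ∀ x, x ≠ v → g x = 1 + (L *ᵥ g) x) {ε : ℝ} (hε : 0 ≤ ε) {m : ℕ}
    (hm : tvDist ((L ^ m) v) π ≤ ε) (n : ℕ) (x : V) :
    n * tvDist ((L ^ (m + n)) x) π ≤ n * ε + g x := by
  have hanti : ∀ x, Antitone fun t => tvDist ((L ^ t) x) π :=
    fun x => antitone_nat_of_succ_le fun t => tvDist_pow_succ_le hL hπL t x
  have hsum : ∀ n x, ∑ k ∈ Finset.range n, tvDist ((L ^ (m + k)) x) π ≤ n * ε + g x := by
    intro n
    induction n with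
    | zero => intro x; simpa using hg0 x
    | succ n ih =>
      intro x
      rcases eq_or_ne x v with rfl | hx
      · refine (Finset.sum_le_card_nsmul _ _ ε fun k _ =>
          (hanti x (Nat.le_add_right m k)).trans hm).trans ?_
        simp [hg0 x]
      -- The term `k = 0` is at most `1`, which the `1` in the first-step equation for `g x` pays
      -- for.
      rw [Finset.sum_range_succ']
      have h1 : tvDist ((L ^ (m + 0)) x) π ≤ 1 := by
        have := mem_rowStochastic_iff_sum.1 (pow_mem hL (m + 0))
        exact tvDist_le_one (this.1 x) hπ (this.2 x) hπ1
      have h2 : ∑ k ∈ Finset.range n, tvDist ((L ^ (m + (k + 1))) x) π ≤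
          ∑ y, L x y * (n * ε + g y) := by
        refine (Finset.sum_le_sum fun k _ => tvDist_pow_succ_le_sum hL (m + k) x).trans ?_
        rw [Finset.sum_comm]
        simp_rw [← Finset.mul_sum]
        exact Finset.sum_le_sum fun y _ =>
          mul_le_mul_of_nonneg_left (ih y) ((mem_rowStochastic_iff_sum.1 hL).1 x y)
      simp_rw [mul_add, Finset.sum_add_distrib, ← Finset.sum_mul,
        (mem_rowStochastic_iff_sum.1 hL).2, one_mul] at h2
      have h3 := hg x hx
      simp only [mulVec, dotProduct] at h3
      push_cast
      linarith
  -- Distances decrease in time, so each summand is at least the one at time `m + n`.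
  refine le_trans ?_ (hsum n x)
  have := Finset.card_nsmul_le_sum (Finset.range n)
    (fun k => tvDist ((L ^ (m + k)) x) π) (tvDist ((L ^ (m + n)) x) π)
    fun k hk => hanti x (by have := Finset.mem_range.1 hk; omega)
  simpa using this

end Reversible

/-! ### The walk on a tree -/

namespace ConductanceTree

open Matrix

variable {V : Type*} [Fintype V] [DecidableEq V] [Nontrivial V] (T : ConductanceTree V)

omit [DecidableEq V] in
theorem sum_weight_pos : 0 < ∑ y, T.weight y :=
  Finset.sum_pos (fun x _ => T.weight_pos x) Finset.univ_nonempty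

omit [DecidableEq V] in
theorem stat_pos (x : V) : 0 < T.stat x := div_pos (T.weight_pos x) T.sum_weight_pos

theorem stat_mul_walk (x y : V) : T.stat x * T.walk.1 x y = T.stat y * T.walk.1 y x := by
  have := (T.weight_pos x).ne'
  have := (T.weight_pos y).ne'
  simp only [stat, walk, Matrix.of_apply, T.symm y x]
  field_simp

theorem walk_pos {x y : V} (h : T.graph.Adj x y) : 0 < T.walk.1 x y :=
  div_pos (T.pos x y h) (T.weight_pos x)

theorem walk_eq_zero {x y : V} (h : ¬ T.graph.Adj x y) : T.walk.1 x y = 0 := by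
  simp [walk, T.zero x y h]

theorem stat_vecMul_lazyMatrix : T.stat ᵥ* lazyMatrix T.walk.1 = T.stat := by
  rw [lazyMatrix, vecMul_smul, vecMul_add, stat_vecMul_walk, vecMul_one]
  ext x
  simp
  ring

/-- The minimum principle for functions that are superharmonic off `v`. -/
theorem nonneg_of_superharmonic {v : V} {f : V → ℝ} (hv : 0 ≤ f v)
    (hf : ∀ x, x ≠ v → ∑ y, T.walk.1 x y * f y ≤ f x) (x : V) : 0 ≤ f x := by
  obtain ⟨x₀, hx₀⟩ := Finite.exists_min f
  have hP := mem_rowStochastic_iff_sum.1 T.walk.2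
  -- A minimum attained at a vertex other than `v` is attained at all its neighbours, so it travels
  -- along a walk to `v`.
  suffices h : ∀ x y : V, ∀ _ : T.graph.Walk x y, y = v → f x = f x₀ → f v = f x₀ by
    obtain ⟨w⟩ := T.isTree.1.preconnected x₀ v
    exact ((h x₀ v w rfl rfl).symm ▸ hx₀ x : f v ≤ f x) |> hv.trans
  intro x y w hy hx
  induction w with
  | nil => exact hy ▸ hx
  | @cons x z y hadj w ih =>
    rcases eq_or_ne x v with rfl | hxv
    · exact hx
    refine ih hy (le_antisymm ?_ (hx₀ z))
    have hsum : ∑ y, T.walk.1 x y * (f y - f x₀) ≤ 0 := by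
      simp_rw [mul_sub, Finset.sum_sub_distrib, ← Finset.sum_mul, hP.2, one_mul]
      linarith [hf x hxv]
    have hterm := (Finset.single_le_sum (f := fun y => T.walk.1 x y * (f y - f x₀))
      (fun y _ => mul_nonneg (hP.1 x y) (sub_nonneg.2 (hx₀ y))) (Finset.mem_univ z)).trans hsum
    linarith [nonpos_of_mul_nonpos_right hterm (T.walk_pos hadj)]

/-- The operator `I - P` with a Dirichlet condition at `v` is injective by the minimum principle,
hence surjective in finite dimension; the same principle makes the solution nonnegative. By
`expHitTime_le` it bounds the expected hitting times, so these are finite. -/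
theorem exists_firstStep_solution (v : V) : ∃ s : V → ℝ, (∀ x, 0 ≤ s x) ∧
    ∀ x, x ≠ v → s x = 1 + ∑ y, T.walk.1 x y * s y := by
  let A : (V → ℝ) →ₗ[ℝ] (V → ℝ) :=
    { toFun := fun f x => if x = v then f v else f x - ∑ y, T.walk.1 x y * f y
      map_add' := fun f g => by
        ext x
        simp only [Pi.add_apply, mul_add, Finset.sum_add_distrib]
        split_ifs <;> ring
      map_smul' := fun c f => by
        ext x
        simp only [Pi.smul_apply, smul_eq_mul, RingHom.id_apply, mul_left_comm _ c,
          ← Finset.mul_sum]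
        split_ifs <;> ring }
  have hA : ∀ f, (∀ x, 0 ≤ A f x) → ∀ x, 0 ≤ f x := by
    intro f hf
    refine T.nonneg_of_superharmonic (v := v) (by simpa [A] using hf v) fun x hx => ?_
    simpa [A, hx] using hf x
  have hinj : Function.Injective A := by
    refine (injective_iff_map_eq_zero A).2 fun f hf => funext fun x => le_antisymm ?_ ?_
    · simpa using hA (-f) (by simp [hf]) x
    · exact hA f (by simp [hf]) x
  obtain ⟨s, hs⟩ := LinearMap.injective_iff_surjective.1 hinj fun x => if x = v then 0 else 1
  refine ⟨s, hA s fun x => ?_, fun x hx => ?_⟩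
  · simp only [hs]
    split_ifs <;> norm_num
  · have := congrFun hs x
    simp only [A, LinearMap.coe_mk, AddHom.coe_mk, if_neg hx] at this
    linarith

theorem lazyMatrix_walk_eq_zero {x y : V} (hxy : x ≠ y) (h : ¬ T.graph.Adj x y) :
    lazyMatrix T.walk.1 x y = 0 := by
  simp [lazyMatrix, T.walk_eq_zero h, hxy]

/-! ### Hitting times on the tree and the two comparisons with the mixing time -/

variable [MeasurableSpace V] [DiscreteMeasurableSpace V]

theorem expHitTime_ne_top (v x : V) : expHitTime T.walk x {v} ≠ ∞ := by
  obtain ⟨s, hs0, hs⟩ := T.exists_firstStep_solution v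
  have hP := mem_rowStochastic_iff_sum.1 T.walk.2
  refine ne_top_of_le_ne_top ENNReal.ofReal_ne_top
    (expHitTime_le T.walk (s := fun x => ENNReal.ofReal (s x)) (fun x hx => ?_) x)
  simp_rw [← ENNReal.ofReal_mul (hP.1 _ _)]
  rw [← ENNReal.ofReal_sum_of_nonneg fun y _ => mul_nonneg (hP.1 x y) (hs0 y),
    ← ENNReal.ofReal_one, ← ENNReal.ofReal_add zero_le_one
      (Finset.sum_nonneg fun y _ => mul_nonneg (hP.1 x y) (hs0 y)), ← hs x hx]

theorem maxHit_ne_top (v : V) : T.maxHit v ≠ ∞ := by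
  obtain ⟨x, hx⟩ := Finite.exists_max fun x => expHitTime T.walk x {v}
  exact ne_top_of_le_ne_top (T.expHitTime_ne_top v x) (iSup_le hx)

/-- The expected hitting time of `v` by the lazy walk, which is twice that of the walk. -/
noncomputable def lazyHit (v x : V) : ℝ := 2 * (expHitTime T.walk x {v}).toReal

theorem lazyHit_nonneg (v x : V) : 0 ≤ T.lazyHit v x :=
  mul_nonneg zero_le_two ENNReal.toReal_nonneg

theorem lazyHit_self (v : V) : T.lazyHit v v = 0 := by simp [lazyHit, expHitTime_self]

/-- If `h = 1 + P h` at `x`, then `(P(2h) + 2h) / 2 = P h + h = 2h - 1` there. -/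
theorem lazyHit_of_ne {v x : V} (hx : x ≠ v) :
    T.lazyHit v x = 1 + (lazyMatrix T.walk.1 *ᵥ T.lazyHit v) x := by
  have hP := mem_rowStochastic_iff_sum.1 T.walk.2
  have h := congrArg ENNReal.toReal (expHitTime_of_ne T.walk hx)
  have hfin : ∀ y ∈ Finset.univ, ENNReal.ofReal (T.walk.1 x y) * expHitTime T.walk y {v} ≠ ∞ :=
    fun y _ => ENNReal.mul_ne_top ENNReal.ofReal_ne_top (T.expHitTime_ne_top v y)
  rw [ENNReal.toReal_add ENNReal.one_ne_top (ENNReal.sum_ne_top.2 hfin),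
    ENNReal.toReal_sum hfin] at h
  simp_rw [ENNReal.toReal_mul, ENNReal.toReal_ofReal (hP.1 _ _)] at h
  rw [lazyMatrix_mulVec]
  simp only [mulVec, dotProduct, lazyHit, mul_left_comm _ (2 : ℝ), ← Finset.mul_sum]
  rw [ENNReal.toReal_one] at h
  linarith

theorem lazyHit_le (v x : V) : T.lazyHit v x ≤ 2 * (T.maxHit v).toReal :=
  mul_le_mul_of_nonneg_left (ENNReal.toReal_mono (T.maxHit_ne_top v)
    (le_iSup (fun x => expHitTime T.walk x {v}) x)) zero_le_two

theorem one_le_maxHit (v : V) : 1 ≤ T.maxHit v := by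
  obtain ⟨x, hx⟩ := exists_ne v
  refine le_trans ?_ (le_iSup (fun x => expHitTime T.walk x {v}) x)
  rw [expHitTime_of_ne T.walk hx]
  exact le_self_add

theorem maxHit_le_of_lazyDist_le {v : V} (hv : T.IsCentral v) {t : ℕ}
    (ht : lazyDist T.walk.1 T.stat t ≤ 1 / 4) : T.maxHit v ≤ 2 * t := by
  set L := lazyMatrix T.walk.1 with hLdef
  have hL : L ∈ rowStochastic ℝ V := lazyMatrix_mem_rowStochastic T.walk.2
  obtain ⟨z, hz⟩ := Finite.exists_max (T.lazyHit v)
  set M := T.lazyHit v z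
  have hM0 : 0 ≤ M := T.lazyHit_nonneg v z
  have hlow : ∀ x, x ≠ v → T.lazyHit v x ≤ t + M * (3 / 4) := by
    intro x hx
    let K := (T.graph.induce ({v}ᶜ : Set V)).connectedComponentMk ⟨x, hx⟩
    have hxK : x ∈ Subtype.val '' K.supp := ⟨⟨x, hx⟩, rfl, rfl⟩
    have hneK : ∀ y ∈ Subtype.val '' K.supp, y ≠ v := by
      rintro _ ⟨y, -, rfl⟩
      exact y.2
    have hclosed : ∀ a ∈ Subtype.val '' K.supp, ∀ b ∉ Subtype.val '' K.supp, b ≠ v →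
        L a b = 0 := by
      rintro _ ⟨a, ha, rfl⟩ b hb hbv
      refine T.lazyMatrix_walk_eq_zero (fun hab => hb (hab ▸ ⟨a, ha, rfl⟩)) fun hadj => hb ?_
      have hadj' : (T.graph.induce ({v}ᶜ : Set V)).Adj a ⟨b, hbv⟩ := hadj
      exact ⟨⟨b, hbv⟩, (K.mem_supp_congr_adj hadj').1 ha, rfl⟩
    refine (le_add_mul_sum_indicator_pow hL hclosed (T.lazyHit_self v)
      (fun y hy => T.lazyHit_of_ne (hneK y hy)) hz t x hxK).trans ?_
    have h1 := sum_indicator_le_add_tvDist ((mem_rowStochastic_iff_sum.1 (pow_mem hL t)).2 x)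
      T.sum_stat (Subtype.val '' K.supp)
    have h2 : tvDist ((L ^ t) x) T.stat ≤ 1 / 4 :=
      (le_ciSup (f := fun x => tvDist ((L ^ t) x) T.stat) (Set.finite_range _).bddAbove x).trans ht
    have h3 : ∑ y, (Subtype.val '' K.supp).indicator T.stat y ≤ 1 / 2 := hv K
    gcongr
    linarith
  -- At the maximiser `z ≠ v`, `hlow` reads `M ≤ t + 3M/4`.
  have hM : M ≤ 4 * t := by
    rcases eq_or_ne z v with hzv | hzv
    · have : M = 0 := by simp only [M, hzv, lazyHit_self]
      rw [this]
      positivity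
    · linarith [hlow z hzv]
  refine iSup_le fun x => ?_
  have h4 : (expHitTime T.walk x {v}).toReal ≤ 2 * t := by
    have := (hz x).trans hM
    rw [lazyHit] at this
    linarith
  have h5 := (ENNReal.le_ofReal_iff_toReal_le (T.expHitTime_ne_top v x) (by positivity)).2 h4
  rwa [ENNReal.ofReal_mul zero_le_two, ENNReal.ofReal_natCast, ENNReal.ofReal_ofNat] at h5

theorem lazyMix_le (v : V) : T.lazyMix ≤ 50 * T.maxHit v := by
  set L := lazyMatrix T.walk.1 with hLdef
  have hL : L ∈ rowStochastic ℝ V := lazyMatrix_mem_rowStochastic T.walk.2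
  set H := (T.maxHit v).toReal with hH
  have hH1 : 1 ≤ H := (ENNReal.toReal_mono (T.maxHit_ne_top v) (T.one_le_maxHit v))
  set m := ⌈32 * H⌉₊
  set n := ⌈16 * H⌉₊
  have hm : 32 * H ≤ m := Nat.le_ceil _
  have hn : 16 * H ≤ n := Nat.le_ceil _
  have hm' : (m : ℝ) < 32 * H + 1 := Nat.ceil_lt_add_one (by positivity)
  have hn' : (n : ℝ) < 16 * H + 1 := Nat.ceil_lt_add_one (by positivity)
  have hv : tvDist ((L ^ m) v) T.stat ≤ 1 / 8 := by
    have h := tvDist_lazyMatrix_pow_le T.walk.2 T.stat_pos T.sum_stat T.stat_mul_walk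
      (T.lazyHit_self v) (fun x hx => T.lazyHit_of_ne hx) (T.lazyHit_le v) m
    by_contra! hlt
    have h1 : (1 / 4 : ℝ) ^ 2 < (2 * tvDist ((L ^ m) v) T.stat) ^ 2 := by
      gcongr
      linarith
    have h2 : (m : ℝ) * (1 / 4) ^ 2 < m * (2 * tvDist ((L ^ m) v) T.stat) ^ 2 :=
      mul_lt_mul_of_pos_left h1 (by linarith)
    linarith
  have hdist : lazyDist T.walk.1 T.stat (m + n) ≤ 1 / 4 := by
    refine ciSup_le fun x => ?_
    have h := mul_tvDist_pow_add_le hL (fun x => (T.stat_pos x).le) T.sum_stat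
      T.stat_vecMul_lazyMatrix (T.lazyHit_nonneg v) (fun x hx => T.lazyHit_of_ne hx)
      (by norm_num) hv n x
    have hn0 : (0 : ℝ) < n := by linarith
    refine le_of_mul_le_mul_left (h.trans ?_) hn0
    linarith [T.lazyHit_le v x]
  refine (iInf₂_le (m + n) hdist).trans ?_
  -- Rounding up costs at most `2 ≤ 2H`, on top of `48H`.
  have h : ((m + n : ℕ) : ℝ) ≤ 50 * H := by
    push_cast
    linarith
  have h' := ENNReal.ofReal_le_ofReal h
  rwa [ENNReal.ofReal_natCast, ENNReal.ofReal_mul (by norm_num), ENNReal.ofReal_ofNat, hH,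
    ENNReal.ofReal_toReal (T.maxHit_ne_top v)] at h'

end ConductanceTree

theorem mainTheorem11 :
    ∃ a b : ℝ≥0, 0 < a ∧ 0 < b ∧
      ∀ (V : Type*) [Fintype V] [DecidableEq V] [Nontrivial V]
        [MeasurableSpace V] [DiscreteMeasurableSpace V] (T : ConductanceTree V) (v : V),
        T.IsCentral v →
          T.lazyMix ≠ ∞ ∧ T.maxHit v ≠ ∞ ∧
            a * T.maxHit v ≤ T.lazyMix ∧ T.lazyMix ≤ b * T.maxHit v := by
  refine ⟨2⁻¹, 50, by positivity, by positivity, fun V _ _ _ _ _ T v hv => ?_⟩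
  refine ⟨ne_top_of_le_ne_top (ENNReal.mul_ne_top (by simp) (T.maxHit_ne_top v)) (T.lazyMix_le v),
    T.maxHit_ne_top v, ?_, by simpa using T.lazyMix_le v⟩
  refine le_iInf₂ fun t ht => ?_
  have h := T.maxHit_le_of_lazyDist_le hv ht
  rw [ENNReal.coe_inv two_ne_zero, mul_comm]
  refine ENNReal.div_le_of_le_mul ?_
  rwa [mul_comm]
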